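/- Let $L\ge 1$, let $\rho=\rho_{0,1}\in(0,1)$ and $\rho_{\ell-1,\ell}\in(0,1]$ for $2\le \ell\le L$ (so $\min_{2\le\ell\le L}\rho_{\ell-1,\ell}>0$). Let $f_0,f_1$ be probability densities with respect to a common reference measure (the pre- and post-change densities), and let $D(f_1,f_0)=\int \log\frac{f_1(x)}{f_0(x)}\,f_1(x)\,dx\in[0,\infty]$ be their Kullback--Leibler divergence. The change-points $\Gamma_1\le\dots\le\Gamma_L$ of $L$ sensors follow the joint-geometric model: $P(\Gamma_1=m)=\rho(1-\rho)^m$ for $m\ge 0$, and $(\Gamma_\ell)_{\ell}$ is Markov in $\ell$ with $P(\Gamma_\ell=m_1+m_2\mid\Gamma_{\ell-1}=m_2)=\rho_{\ell-1,\ell}(1-\rho_{\ell-1,\ell})^{m_1}$ for $m_1,m_2\ge 0$, $2\le\ell\le L$. Conditionally on $(\Gamma_1,\dots,\Gamma_L)$, the observations $Z_{k,\ell}$ ($k\ge 1$, $1\le\ell\le L$) are independent, $Z_{k,\ell}$ having density $f_0$ if $k<\Gamma_\ell$ and $f_1$ if $k\ge\Gamma_\ell$. For a stopping time $\tau$, with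 values in $\{0,1,2,\dots\}\cup\{\infty\}$, of the filtration $\mathcal F_k=\sigma(Z_{i,\ell}: 1\le i\le k,\ 1\le\ell\le L)$, let $P_{\mathsf{FA}}(\tau)=P(\tau<\Gamma_1)$, $E_{\mathsf{DD}}(\tau)=E[(\tau-\Gamma_1)^+]\in[0,\infty]$, and let $\mathbf{\Delta}_\alpha=\{\tau: P_{\mathsf{FA}}(\tau)\le\alpha\}$. Then, as $\alpha\to 0^+$, $$\inf_{\tau\in\mathbf{\Delta}_\alpha}E_{\mathsf{DD}}(\tau)\ \ge\ \frac{\log\!\big(\frac{1}{\rho\alpha}\big)\,(1+o(1))}{L\,D(f_1,f_0)+|\log(1-\rho)|},$$ where the $o(1)$ term depends only on $\alpha$, $L$, the parameters $\rho_{\ell-1,\ell}$ and $f_0,f_1$ (and the right-hand side is read as $0$ if $D(f_1,f_0)=\infty$). -/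

import Mathlib

open MeasureTheory ProbabilityTheory InformationTheory Filter Topology
open scoped ENNReal

/-- The law of the vector of change-points `(Γ_1, …, Γ_L)` under the joint-geometric model:
`Γ_1` is geometric on `{0, 1, 2, …}` with parameter `ρ_{0,1}`, and the propagation delays
`Γ_ℓ - Γ_{ℓ-1}` are geometric on `{0, 1, 2, …}` with parameters `ρ_{ℓ-1,ℓ}`, all independent.
Sensors are numbered from `0` here, so `ρ ℓ` is the parameter leading to sensor `ℓ + 1`
of the usual numbering. -/
noncomputable def changePointLaw {L : ℕ} (ρ : Fin L → unitInterval) : Measure (Fin L → ℕ) :=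
  (Measure.pi fun ℓ => geometricMeasure (ρ ℓ)).map fun d ℓ => ∑ j ∈ Finset.Iic ℓ, d j

/-- The law of the array of observations when the change-points are `γ`: all observations are
independent, the one of sensor `ℓ` at time `t` having distribution `μ₀` if `t < γ ℓ` and `μ₁`
if `t ≥ γ ℓ`. Observation times are `t = 1, 2, 3, …`; the coordinate `k` is time `t = k + 1`. -/
noncomputable def observationLaw {L : ℕ} {𝓧 : Type*} [MeasurableSpace 𝓧] (μ₀ μ₁ : Measure 𝓧)
    (γ : Fin L → ℕ) : Measure (ℕ → Fin L → 𝓧) :=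
  Measure.infinitePi fun k => Measure.pi fun ℓ => if k + 1 < γ ℓ then μ₀ else μ₁

/-- An `L`-sensor system with a change process: the change-points `Γ` follow the joint-geometric
model with parameters `ρ`, and, conditionally on `Γ = γ`, the observations have the law
`observationLaw μ₀ μ₁ γ`. Here `Z k ℓ` is the observation of sensor `ℓ` at time `k + 1`. -/
structure IsChangeProcessSystem {Ω 𝓧 : Type*} [MeasurableSpace Ω] [MeasurableSpace 𝓧] {L : ℕ}
    (ρ : Fin L → unitInterval) (μ₀ μ₁ : Measure 𝓧) (P : Measure Ω)
    (Γ : Fin L → Ω → ℕ) (Z : ℕ → Fin L → Ω → 𝓧) : Prop where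
  measurable_changePoint : ∀ ℓ, Measurable (Γ ℓ)
  measurable_obs : ∀ k ℓ, Measurable (Z k ℓ)
  law_changePoint : P.map (fun ω ℓ => Γ ℓ ω) = changePointLaw ρ
  condLaw_obs : ∀ (γ : Fin L → ℕ) (A : Set (ℕ → Fin L → 𝓧)), MeasurableSet A →
    P {ω | (∀ ℓ, Γ ℓ ω = γ ℓ) ∧ (fun k ℓ => Z k ℓ ω) ∈ A} =
      P {ω | ∀ ℓ, Γ ℓ ω = γ ℓ} * observationLaw μ₀ μ₁ γ A

/-- The information of the fusion center: at time `n` it knows the observations of all sensors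
at the times `1, …, n` (and nothing at time `0`). -/
def obsFiltration {Ω 𝓧 : Type*} [mΩ : MeasurableSpace Ω] [m𝓧 : MeasurableSpace 𝓧] {L : ℕ}
    (Z : ℕ → Fin L → Ω → 𝓧) (hZ : ∀ k ℓ, Measurable (Z k ℓ)) : Filtration ℕ mΩ where
  seq n := ⨆ (k : ℕ) (_ : k < n) (ℓ : Fin L), m𝓧.comap (Z k ℓ)
  mono' _ _ hmn := iSup_mono fun _ => iSup_mono' fun hk => ⟨hk.trans_le hmn, le_rfl⟩
  le' _ := iSup_le fun k => iSup_le fun _ => iSup_le fun ℓ => (hZ k ℓ).comap_le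

/-- The probability of false alarm `P(τ < Γ_1)`; `G` is the first change-point `Γ_1`. -/
noncomputable def falseAlarmProb {Ω : Type*} [MeasurableSpace Ω] (P : Measure Ω) (G : Ω → ℕ)
    (τ : Ω → ℕ∞) : ℝ≥0∞ :=
  P {ω | τ ω < G ω}

/-- The expected detection delay `E[(τ - Γ_1)^+]`, in `[0, ∞]`; `G` is the first change-point
`Γ_1`. Subtraction in `ℕ∞` is truncated at `0`, so it is the positive part. -/
noncomputable def expectedDelay {Ω : Type*} [MeasurableSpace Ω] (P : Measure Ω) (G : Ω → ℕ)
    (τ : Ω → ℕ∞) : ℝ≥0∞ :=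
  ∫⁻ ω, ((τ ω - (G ω : ℕ∞) : ℕ∞) : ℝ≥0∞) ∂P

/-- The class `Δ_α` of stopping times of the filtration `ℱ` whose probability of false alarm
does not exceed `α`. -/
def detectionClass {Ω : Type*} [mΩ : MeasurableSpace Ω] (P : Measure Ω) (ℱ : Filtration ℕ mΩ)
    (G : Ω → ℕ) (α : ℝ) : Set (Ω → ℕ∞) :=
  {τ | IsStoppingTime ℱ τ ∧ falseAlarmProb P G τ ≤ ENNReal.ofReal α}

/-! The proof is a Jensen argument for the change of measure from the no-change law `P_∞` to the law
given change-points `γ` with first change-point `m`. Write `q = 1 - ρ 0` and let `S_T` be the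
log-likelihood ratio at the stopping time. On `{τ = n}` the observations up to `n` do not feel a
change after `n`, so the false-alarm probability is at least `E_∞[q^(τ+1)]`. Changing measure turns
the constraint into `E_γ[q^(T+1) exp(-S_T)] ≤ α`, up to truncation of `τ`. Jensen then gives `-log α
≤ E_γ[S_T] + |log q| (E_γ[T] + 1)`.

By Wald's argument (`integral_sum_stepLLR_le`), `E_γ[S_T]` is at most `L D` times the mean delay
plus one. Hence `-log α` is at most `(L D + |log q|)` times the mean delay, plus a term affine in
`m` (`neg_log_le_delay`). Averaging over `γ` replaces that term by a finite constant, because the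
geometric law has a mean (`neg_log_le_expectedDelay`). This constant and `log (ρ 0)` are absorbed
into the `o(1)`. Only the law of the first change-point and its being the earliest matter. -/

/-! ### Change of measure on product spaces -/

/-- A product of densities gives a measure dominated by the product of the dominating measures. -/
lemma pi_withDensity_prod_le {ι : Type*} [Fintype ι] {X : ι → Type*}
    [∀ i, MeasurableSpace (X i)] (μ κ : ∀ i, Measure (X i)) [∀ i, IsProbabilityMeasure (μ i)]
    [∀ i, SigmaFinite (κ i)] (a : ∀ i, X i → ℝ≥0∞) (ha : ∀ i, Measurable (a i))
    (h : ∀ i, (μ i).withDensity (a i) ≤ κ i) :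
    (Measure.pi μ).withDensity (fun x => ∏ i, a i (x i)) ≤ Measure.pi κ := by
  -- Domination on boxes alone does not in general extend to all measurable sets. It does here
  -- because `OuterMeasure.pi` is the largest outer measure bounded by the product on boxes.
  have key : ((Measure.pi μ).withDensity (fun x => ∏ i, a i (x i))).toOuterMeasure ≤
      OuterMeasure.pi fun i => (κ i).toOuterMeasure := by
    rw [OuterMeasure.le_pi]
    intro s _
    -- The sides of the boxes in `OuterMeasure.le_pi` are arbitrary sets; measurable hulls do not
    -- change their `κ i`-measure.
    have hm : ∀ i, MeasurableSet (toMeasurable (κ i) (s i)) := fun i =>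
      measurableSet_toMeasurable _ _
    have hmp : MeasurableSet (Set.univ.pi fun i => toMeasurable (κ i) (s i)) :=
      MeasurableSet.univ_pi hm
    calc ((Measure.pi μ).withDensity fun x => ∏ i, a i (x i)) (Set.univ.pi s)
        ≤ ((Measure.pi μ).withDensity fun x => ∏ i, a i (x i))
            (Set.univ.pi fun i => toMeasurable (κ i) (s i)) :=
          measure_mono (Set.pi_mono fun i _ => subset_toMeasurable _ _)
      _ = ∫⁻ x, ∏ i, (toMeasurable (κ i) (s i)).indicator (a i) (x i) ∂Measure.pi μ := by
          rw [withDensity_apply _ hmp, ← lintegral_indicator hmp]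
          congr 1 with x
          by_cases hx : x ∈ Set.univ.pi fun i => toMeasurable (κ i) (s i)
          · rw [Set.indicator_of_mem hx]
            exact Finset.prod_congr rfl fun i _ =>
              (Set.indicator_of_mem (hx i (Set.mem_univ i)) _).symm
          · rw [Set.indicator_of_notMem hx]
            simp only [Set.mem_pi, Set.mem_univ, true_implies, not_forall] at hx
            obtain ⟨i, hi⟩ := hx
            exact (Finset.prod_eq_zero (Finset.mem_univ i) (Set.indicator_of_notMem hi _)).symm
      _ = ∏ i, ∫⁻ x, (toMeasurable (κ i) (s i)).indicator (a i) x ∂μ i := by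
          have hg : ∀ i, Measurable ((toMeasurable (κ i) (s i)).indicator (a i)) := fun i =>
            (ha i).indicator (hm i)
          rw [lintegral_prod_eq_prod_lintegral_of_indepFun Finset.univ
            (fun i (x : ∀ i, X i) => (toMeasurable (κ i) (s i)).indicator (a i) (x i))
            (iIndepFun_pi fun i => (hg i).aemeasurable)
            (fun i => (hg i).comp (measurable_pi_apply i))]
          exact Finset.prod_congr rfl fun i _ =>
            (measurePreserving_eval μ i).lintegral_comp (hg i)
      _ = ∏ i, (μ i).withDensity (a i) (toMeasurable (κ i) (s i)) := by
          refine Finset.prod_congr rfl fun i _ => ?_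
          rw [withDensity_apply _ (hm i), lintegral_indicator (hm i)]
      _ ≤ ∏ i, κ i (s i) := by
          refine Finset.prod_le_prod' fun i _ => ?_
          rw [← measure_toMeasurable (s i)]
          exact h i _
  refine Measure.le_iff.2 fun s hs => ?_
  conv_rhs => rw [Measure.pi, toMeasure_apply _ _ hs]
  exact key s

/-- The events of a product space that depend only on the coordinates `0, …, n - 1`. -/
abbrev pastEvents (X : Type*) [MeasurableSpace X] (n : ℕ) : MeasurableSpace (ℕ → X) :=
  MeasurableSpace.comap (Finset.restrict (Finset.range n)) MeasurableSpace.pi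

lemma pastEvents_le (X : Type*) [MeasurableSpace X] (n : ℕ) :
    pastEvents X n ≤ MeasurableSpace.pi :=
  (Finset.measurable_restrict (Finset.range n)).comap_le

lemma pastEvents_mono (X : Type*) [MeasurableSpace X] {m n : ℕ} (hmn : m ≤ n) :
    pastEvents X m ≤ pastEvents X n := by
  have : (Finset.restrict (Finset.range m) : (ℕ → X) → _) =
      Finset.restrict₂ (Finset.range_subset_range.2 hmn) ∘ Finset.restrict (Finset.range n) := rfl
  rw [pastEvents, this, ← MeasurableSpace.comap_comp]
  exact MeasurableSpace.comap_mono (Finset.measurable_restrict₂ _).comap_le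

/-- Change of measure over finitely many independent coordinates, as an inequality. -/
lemma setLIntegral_infinitePi_prod_le {X : Type*} [MeasurableSpace X] (μ κ : ℕ → Measure X)
    [∀ k, IsProbabilityMeasure (μ k)] [∀ k, IsProbabilityMeasure (κ k)] (a : ℕ → X → ℝ≥0∞)
    (ha : ∀ k, Measurable (a k)) (n : ℕ) (h : ∀ k < n, (μ k).withDensity (a k) ≤ κ k)
    {A : Set (ℕ → X)} (hA : MeasurableSet[pastEvents X n] A) :
    ∫⁻ z in A, ∏ k ∈ Finset.range n, a k (z k) ∂Measure.infinitePi μ ≤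
      Measure.infinitePi κ A := by
  obtain ⟨B, hB, rfl⟩ := hA
  have hr : Measurable (Finset.restrict (Finset.range n) : (ℕ → X) → _) :=
    Finset.measurable_restrict _
  have hprod : Measurable fun x : (Finset.range n → X) => ∏ k : Finset.range n, a k (x k) :=
    Finset.measurable_prod _ fun k _ => (ha k).comp (measurable_pi_apply k)
  calc ∫⁻ z in Finset.restrict (Finset.range n) ⁻¹' B, ∏ k ∈ Finset.range n, a k (z k)
        ∂Measure.infinitePi μ
      = ∫⁻ z in Finset.restrict (Finset.range n) ⁻¹' B,
          (fun x : (Finset.range n → X) => ∏ k : Finset.range n, a k (x k)) (Finset.restrict (Finset.range n) z)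
          ∂Measure.infinitePi μ := by
        congr 1 with z
        exact (Finset.prod_coe_sort (Finset.range n) fun k => a k (z k)).symm
    _ = ((Measure.pi fun k : Finset.range n => μ k).withDensity
          fun x => ∏ k : Finset.range n, a k (x k)) B := by
        rw [← setLIntegral_map hB hprod hr, Measure.infinitePi_map_restrict,
          withDensity_apply _ hB]
    _ ≤ (Measure.pi fun k : Finset.range n => κ k) B :=
        pi_withDensity_prod_le _ _ (fun k : Finset.range n => a k) (fun k => ha k)
          (fun k => h k (Finset.mem_range.1 k.2)) B
    _ = Measure.infinitePi κ (Finset.restrict (Finset.range n) ⁻¹' B) := by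
        rw [← Measure.map_apply hr hB, Measure.infinitePi_map_restrict]

lemma infinitePi_congr_of_pastEvents {X : Type*} [MeasurableSpace X] (μ κ : ℕ → Measure X)
    [∀ k, IsProbabilityMeasure (μ k)] [∀ k, IsProbabilityMeasure (κ k)] (n : ℕ)
    (h : ∀ k < n, μ k = κ k) {A : Set (ℕ → X)} (hA : MeasurableSet[pastEvents X n] A) :
    Measure.infinitePi μ A = Measure.infinitePi κ A := by
  obtain ⟨B, hB, rfl⟩ := hA
  have hr : Measurable (Finset.restrict (Finset.range n) : (ℕ → X) → _) :=
    Finset.measurable_restrict _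
  rw [← Measure.map_apply hr hB, ← Measure.map_apply hr hB, Measure.infinitePi_map_restrict,
    Measure.infinitePi_map_restrict]
  congr 2 with k
  rw [h k (Finset.mem_range.1 k.2)]

/-- The function `exp (-llr μ ν)` is `μ`-a.e. the density of the absolutely continuous part of `ν`
with respect to `μ`. Equality fails when `ν` has a singular part, so every later change of measure
is an inequality, which is the direction needed. -/
lemma withDensity_exp_neg_llr_le {X : Type*} [MeasurableSpace X] (μ ν : Measure X)
    [SigmaFinite μ] [SigmaFinite ν] (h : μ ≪ ν) :
    μ.withDensity (fun x => ENNReal.ofReal (Real.exp (-llr μ ν x))) ≤ ν := by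
  have : (fun x => ENNReal.ofReal (Real.exp (-llr μ ν x))) =ᵐ[μ] ν.rnDeriv μ := by
    filter_upwards [exp_neg_llr h, ν.rnDeriv_lt_top μ] with x hx hx'
    rw [hx, ENNReal.ofReal_toReal hx'.ne]
  rw [withDensity_congr_ae this]
  exact Measure.withDensity_rnDeriv_le ν μ

/-- An event of the past and an integrable function of the present are independent. -/
lemma setIntegral_infinitePi_of_pastEvents {X : Type*} [MeasurableSpace X] (μ : ℕ → Measure X)
    [∀ k, IsProbabilityMeasure (μ k)] (k : ℕ) {A : Set (ℕ → X)}
    (hA : MeasurableSet[pastEvents X k] A) {f : X → ℝ} (hf : Measurable f) :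
    ∫ z in A, f (z k) ∂Measure.infinitePi μ = (Measure.infinitePi μ).real A * ∫ x, f x ∂μ k := by
  have hA' := pastEvents_le X k A hA
  obtain ⟨B, hB, rfl⟩ := hA
  have hr : Measurable (Finset.restrict (Finset.range k) : (ℕ → X) → _) :=
    Finset.measurable_restrict _
  have hind : IndepFun (fun (z : ℕ → X) (i : Finset.range k) => z i) (fun z => z k)
      (Measure.infinitePi μ) := by
    have h0 := iIndepFun_infinitePi (P := μ) (X := fun _ x => x) (fun _ => measurable_id)
    have h1 := h0.indepFun_finset (Finset.range k) {k} (by simp) (fun i => measurable_pi_apply i)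
    exact h1.comp (φ := id) (ψ := fun x => x ⟨k, by simp⟩) measurable_id
      (measurable_pi_apply (X := fun _ : ({k} : Finset ℕ) => X) ⟨k, by simp⟩)
  have h2 := (hind.comp (φ := B.indicator fun _ => (1 : ℝ)) (ψ := f)
    (measurable_const.indicator hB) hf).integral_fun_mul_eq_mul_integral
      ((measurable_const.indicator hB).comp hr).aestronglyMeasurable
      (hf.comp (measurable_pi_apply k)).aestronglyMeasurable
  rw [← integral_indicator hA']
  calc _ = ∫ z, ((B.indicator fun _ => (1 : ℝ)) ∘ fun (z : ℕ → X) (i : Finset.range k) => z i) z *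
        (f ∘ fun z => z k) z ∂Measure.infinitePi μ := by
        congr 1 with z
        by_cases hz : Finset.restrict (Finset.range k) z ∈ B
        · have : (fun i : Finset.range k => z i) ∈ B := hz
          simp [Set.indicator, hz, this]
        · have : (fun i : Finset.range k => z i) ∉ B := hz
          simp [Set.indicator, hz, this]
    _ = _ := h2
    _ = _ := by
        congr 1
        · rw [← integral_indicator_one hA']
          rfl
        · have := (measurePreserving_eval_infinitePi μ k).map_eq
          rw [← this, integral_map (measurable_pi_apply k).aemeasurable hf.aestronglyMeasurable]
          rfl

/-! ### Delay bounds for fixed change-points -/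

section Delay

variable {L : ℕ} {𝓧 : Type*} [MeasurableSpace 𝓧]

instance isProbabilityMeasure_pi_ite (μ₀ μ₁ : Measure 𝓧) [IsProbabilityMeasure μ₀]
    [IsProbabilityMeasure μ₁] (γ : Fin L → ℕ) (k : ℕ) :
    IsProbabilityMeasure (Measure.pi fun ℓ => if k + 1 < γ ℓ then μ₀ else μ₁) := by
  have : ∀ ℓ, IsProbabilityMeasure (if k + 1 < γ ℓ then μ₀ else μ₁) := fun ℓ => by
    split_ifs <;> infer_instance
  infer_instance

instance isProbabilityMeasure_observationLaw (μ₀ μ₁ : Measure 𝓧) [IsProbabilityMeasure μ₀]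
    [IsProbabilityMeasure μ₁] (γ : Fin L → ℕ) :
    IsProbabilityMeasure (observationLaw μ₀ μ₁ γ) := by
  unfold observationLaw
  infer_instance

/-- The law of the observations when no change ever occurs. -/
noncomputable def noChangeLaw (L : ℕ) {𝓧 : Type*} [MeasurableSpace 𝓧] (μ₀ : Measure 𝓧) :
    Measure (ℕ → Fin L → 𝓧) :=
  Measure.infinitePi fun _ => Measure.pi fun _ => μ₀

instance isProbabilityMeasure_noChangeLaw (μ₀ : Measure 𝓧) [IsProbabilityMeasure μ₀] :
    IsProbabilityMeasure (noChangeLaw L μ₀) := by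
  unfold noChangeLaw
  infer_instance

/-- The log-likelihood ratio of the observations at time `k + 1`, for the change-points `γ` against
no change. -/
noncomputable def stepLLR (μ₀ μ₁ : Measure 𝓧) (γ : Fin L → ℕ) (k : ℕ) (x : Fin L → 𝓧) : ℝ :=
  ∑ ℓ, if k + 1 < γ ℓ then 0 else llr μ₁ μ₀ (x ℓ)

lemma measurable_stepLLR (μ₀ μ₁ : Measure 𝓧) (γ : Fin L → ℕ) (k : ℕ) :
    Measurable (stepLLR μ₀ μ₁ γ k) := by
  unfold stepLLR
  refine Finset.measurable_sum _ fun ℓ _ => ?_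
  split_ifs
  · exact measurable_const
  · exact (measurable_llr _ _).comp (measurable_pi_apply ℓ)

/-- The exponential factors over times and sensors: a sensor before its change contributes the
factor one, a sensor after it the inverse likelihood ratio. -/
lemma setLIntegral_exp_neg_stepLLR_le (μ₀ μ₁ : Measure 𝓧) [IsProbabilityMeasure μ₀]
    [IsProbabilityMeasure μ₁] (hac : μ₁ ≪ μ₀) (γ : Fin L → ℕ) (n : ℕ)
    {A : Set (ℕ → Fin L → 𝓧)} (hA : MeasurableSet[pastEvents _ n] A) :
    ∫⁻ z in A, ENNReal.ofReal (Real.exp (-∑ k ∈ Finset.range n, stepLLR μ₀ μ₁ γ k (z k)))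
      ∂observationLaw μ₀ μ₁ γ ≤ noChangeLaw L μ₀ A := by
  have key := setLIntegral_infinitePi_prod_le
    (fun k => Measure.pi fun ℓ => if k + 1 < γ ℓ then μ₀ else μ₁)
    (fun _ => Measure.pi fun _ : Fin L => μ₀)
    (fun k x => ENNReal.ofReal (Real.exp (-stepLLR μ₀ μ₁ γ k x)))
    (fun k => (measurable_stepLLR μ₀ μ₁ γ k).neg.exp.ennreal_ofReal) n ?_ hA
  · refine le_of_eq_of_le ?_ key
    refine lintegral_congr fun z => ?_
    rw [← Finset.sum_neg_distrib, Real.exp_sum,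
      ENNReal.ofReal_prod_of_nonneg fun _ _ => (Real.exp_pos _).le]
  · intro k _
    have hp : ∀ ℓ, IsProbabilityMeasure (if k + 1 < γ ℓ then μ₀ else μ₁) := fun ℓ => by
      split_ifs <;> infer_instance
    refine le_of_eq_of_le ?_ (pi_withDensity_prod_le (fun ℓ => if k + 1 < γ ℓ then μ₀ else μ₁)
      (fun _ : Fin L => μ₀)
      (fun ℓ x => ENNReal.ofReal (Real.exp (-(if k + 1 < γ ℓ then 0 else llr μ₁ μ₀ x)))) ?_ ?_)
    · congr 1 with x
      rw [stepLLR, ← Finset.sum_neg_distrib, Real.exp_sum,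
        ENNReal.ofReal_prod_of_nonneg fun _ _ => (Real.exp_pos _).le]
    · intro ℓ
      split_ifs
      · exact measurable_const
      · exact (measurable_llr _ _).neg.exp.ennreal_ofReal
    · intro ℓ
      split_ifs
      · simp
      · exact withDensity_exp_neg_llr_le μ₁ μ₀ hac

lemma integrable_stepLLR (μ₀ μ₁ : Measure 𝓧) [IsProbabilityMeasure μ₀]
    [IsProbabilityMeasure μ₁] (hint : Integrable (llr μ₁ μ₀) μ₁) (γ : Fin L → ℕ) (k : ℕ) :
    Integrable (stepLLR μ₀ μ₁ γ k) (Measure.pi fun ℓ => if k + 1 < γ ℓ then μ₀ else μ₁) := by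
  have hp : ∀ ℓ, IsProbabilityMeasure (if k + 1 < γ ℓ then μ₀ else μ₁) := fun ℓ => by
    split_ifs <;> infer_instance
  refine integrable_finsetSum _ fun ℓ _ => ?_
  by_cases hℓ : k + 1 < γ ℓ
  · simp [hℓ]
  · have := measurePreserving_eval (fun ℓ => if k + 1 < γ ℓ then μ₀ else μ₁) ℓ
    simp only [hℓ, if_false] at this ⊢
    exact this.integrable_comp_of_integrable hint

lemma integral_stepLLR (μ₀ μ₁ : Measure 𝓧) [IsProbabilityMeasure μ₀]
    [IsProbabilityMeasure μ₁] (hint : Integrable (llr μ₁ μ₀) μ₁) (γ : Fin L → ℕ) (k : ℕ) :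
    ∫ x, stepLLR μ₀ μ₁ γ k x ∂(Measure.pi fun ℓ => if k + 1 < γ ℓ then μ₀ else μ₁) =
      ∑ ℓ, if k + 1 < γ ℓ then 0 else ∫ x, llr μ₁ μ₀ x ∂μ₁ := by
  have hp : ∀ ℓ, IsProbabilityMeasure (if k + 1 < γ ℓ then μ₀ else μ₁) := fun ℓ => by
    split_ifs <;> infer_instance
  have hmp : ∀ ℓ, ¬ k + 1 < γ ℓ → MeasurePreserving (Function.eval ℓ)
      (Measure.pi fun ℓ => if k + 1 < γ ℓ then μ₀ else μ₁) μ₁ := fun ℓ hℓ => by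
    have := measurePreserving_eval (fun ℓ => if k + 1 < γ ℓ then μ₀ else μ₁) ℓ
    simpa only [hℓ, if_false] using this
  unfold stepLLR
  rw [integral_finsetSum]
  · refine Finset.sum_congr rfl fun ℓ _ => ?_
    by_cases hℓ : k + 1 < γ ℓ
    · simp [hℓ]
    · simp only [hℓ, if_false]
      have := integral_map (φ := Function.eval ℓ) (f := llr μ₁ μ₀)
        (measurable_pi_apply ℓ).aemeasurable (measurable_llr _ _).aestronglyMeasurable
        (μ := Measure.pi fun ℓ => if k + 1 < γ ℓ then μ₀ else μ₁)
      rw [(hmp ℓ hℓ).map_eq] at this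
      exact this.symm
  · intro ℓ _
    by_cases hℓ : k + 1 < γ ℓ
    · simp [hℓ]
    · simp only [hℓ, if_false]
      exact (hmp ℓ hℓ).integrable_comp_of_integrable hint

/-- For a stopping time `T` bounded by `N`, the expectation of the log-likelihood ratio at `T` is
at most `D` for every sensor and every time from the first change-point `m` up to `T`. -/
lemma integral_sum_stepLLR_le (μ₀ μ₁ : Measure 𝓧) [IsProbabilityMeasure μ₀]
    [IsProbabilityMeasure μ₁] (hint : Integrable (llr μ₁ μ₀) μ₁)
    (hD : 0 ≤ ∫ x, llr μ₁ μ₀ x ∂μ₁) (γ : Fin L → ℕ) (m : ℕ) (hm : ∀ ℓ, m ≤ γ ℓ)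
    (N : ℕ) (T : (ℕ → Fin L → 𝓧) → ℕ) (hTN : ∀ z, T z ≤ N)
    (hT : ∀ n, MeasurableSet[pastEvents _ n] {z | T z ≤ n}) :
    Integrable (fun z => ∑ k ∈ Finset.range (T z), stepLLR μ₀ μ₁ γ k (z k))
        (observationLaw μ₀ μ₁ γ) ∧
      ∫ z, ∑ k ∈ Finset.range (T z), stepLLR μ₀ μ₁ γ k (z k) ∂observationLaw μ₀ μ₁ γ ≤
        L * (∫ x, llr μ₁ μ₀ x ∂μ₁) *
          (∫ z, ((T z - m : ℕ) : ℝ) ∂observationLaw μ₀ μ₁ γ + 1) := by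
  set D := ∫ x, llr μ₁ μ₀ x ∂μ₁
  set ν := observationLaw μ₀ μ₁ γ
  -- The event `k < T` depends only on the coordinates before `k`, hence is independent of the
  -- `k`-th one. This is what makes Wald's argument work.
  have hgt : ∀ k, MeasurableSet[pastEvents _ k] {z | k < T z} := fun k => by
    have : {z : ℕ → Fin L → 𝓧 | k < T z} = {z | T z ≤ k}ᶜ := by ext; simp
    rw [this]
    exact (hT k).compl
  have hgt' : ∀ k, MeasurableSet {z | k < T z} := fun k => pastEvents_le _ k _ (hgt k)
  have hTm : Measurable T := measurable_of_Iic fun n => pastEvents_le _ n _ (hT n)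
  have hsum : ∀ z, ∑ k ∈ Finset.range (T z), stepLLR μ₀ μ₁ γ k (z k) =
      ∑ k ∈ Finset.range N, {z | k < T z}.indicator (fun z => stepLLR μ₀ μ₁ γ k (z k)) z := by
    intro z
    rw [← Finset.sum_subset (Finset.range_subset_range.2 (hTN z))]
    · exact Finset.sum_congr rfl fun k hk => by simp [Finset.mem_range.1 hk]
    · intro k _ hk
      simpa using fun h : k < T z => absurd (Finset.mem_range.2 h) hk
  have hi : ∀ k, Integrable (fun z : ℕ → Fin L → 𝓧 => stepLLR μ₀ μ₁ γ k (z k)) ν := fun k =>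
    (measurePreserving_eval_infinitePi
      (fun k => Measure.pi fun ℓ => if k + 1 < γ ℓ then μ₀ else μ₁) k).integrable_comp_of_integrable
        (integrable_stepLLR μ₀ μ₁ hint γ k)
  simp_rw [hsum]
  refine ⟨integrable_finsetSum _ fun k _ => (hi k).indicator (hgt' k), ?_⟩
  rw [integral_finsetSum _ fun k _ => (hi k).indicator (hgt' k)]
  -- Before time `m` no sensor has changed and the increment vanishes; from then on each sensor
  -- contributes `0` or `D`, and `0 ≤ D`.
  have hstep : ∀ k, ∫ z, {z | k < T z}.indicator (fun z => stepLLR μ₀ μ₁ γ k (z k)) z ∂ν ≤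
      if k + 1 < m then 0 else ν.real {z | k < T z} * (L * D) := by
    intro k
    rw [integral_indicator (hgt' k)]
    have h1 := setIntegral_infinitePi_of_pastEvents
      (fun k => Measure.pi fun ℓ => if k + 1 < γ ℓ then μ₀ else μ₁) k (hgt k)
      (measurable_stepLLR μ₀ μ₁ γ k)
    rw [integral_stepLLR μ₀ μ₁ hint] at h1
    change ∫ z in {z | k < T z}, stepLLR μ₀ μ₁ γ k (z k) ∂ν = _ at h1
    rw [h1]
    split_ifs with hkm
    · rw [Finset.sum_eq_zero fun ℓ _ => if_pos (hkm.trans_le (hm ℓ)), mul_zero]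
    · refine mul_le_mul_of_nonneg_left ?_ measureReal_nonneg
      calc ∑ ℓ, (if k + 1 < γ ℓ then 0 else D) ≤ ∑ _ℓ : Fin L, D :=
            Finset.sum_le_sum fun ℓ _ => by split_ifs <;> [exact hD; exact le_rfl]
        _ = L * D := by simp
  refine (Finset.sum_le_sum fun k _ => hstep k).trans ?_
  -- Coordinate `k` is time `k + 1`, so the counted times run from `m` to `T` inclusive: at most `(T
  -- - m) + 1` of them.
  have hcount : ∑ k ∈ Finset.range N, (if k + 1 < m then 0 else ν.real {z | k < T z}) ≤
      ∫ z, ((T z - m : ℕ) : ℝ) ∂ν + 1 := by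
    have hint' : Integrable (fun z => ((T z - m : ℕ) : ℝ)) ν :=
      Integrable.of_bound (C := N)
        (by
          have : Measurable fun z => ((T z - m : ℕ) : ℝ) :=
            (measurable_from_top (f := fun n : ℕ => ((n - m : ℕ) : ℝ))).comp hTm
          exact this.aestronglyMeasurable)
        (ae_of_all _ fun z => by
          rw [Real.norm_natCast]
          exact_mod_cast (Nat.sub_le _ _).trans (hTN z))
    have hi' : ∀ k ∈ Finset.range N, Integrable
        (fun z => if k + 1 < m then 0 else {z | k < T z}.indicator (fun _ => (1 : ℝ)) z) ν :=
      fun k _ => by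
        split_ifs
        · simp
        · exact (integrable_const _).indicator (hgt' k)
    calc ∑ k ∈ Finset.range N, (if k + 1 < m then 0 else ν.real {z | k < T z})
        = ∫ z, ∑ k ∈ Finset.range N,
            (if k + 1 < m then 0 else {z | k < T z}.indicator (fun _ => (1 : ℝ)) z) ∂ν := by
          rw [integral_finsetSum _ hi']
          refine Finset.sum_congr rfl fun k _ => ?_
          split_ifs
          · simp
          · exact (integral_indicator_one (hgt' k)).symm
      _ ≤ ∫ z, (((T z - m : ℕ) : ℝ) + 1) ∂ν := by
          refine integral_mono (integrable_finsetSum _ hi') (hint'.add (integrable_const _)) ?_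
          intro z
          have : ∑ k ∈ Finset.range N,
              (if k + 1 < m then 0 else {z | k < T z}.indicator (fun _ => (1 : ℝ)) z) =
              (((Finset.range N).filter fun k => ¬ k + 1 < m ∧ k < T z).card : ℝ) := by
            rw [Finset.card_filter, Nat.cast_sum]
            refine Finset.sum_congr rfl fun k _ => ?_
            by_cases h1 : k + 1 < m <;> by_cases h2 : k < T z <;> simp [h1, h2]
          beta_reduce
          rw [this]
          have hle : ((Finset.range N).filter fun k => ¬ k + 1 < m ∧ k < T z) ⊆
              Finset.Ico (m - 1) (T z) := by
            intro k hk
            simp only [Finset.mem_filter, Finset.mem_Ico] at hk ⊢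
            omega
          have := Finset.card_le_card hle
          rw [Nat.card_Ico] at this
          exact_mod_cast this.trans (by omega)
      _ = ∫ z, ((T z - m : ℕ) : ℝ) ∂ν + 1 := by
          rw [integral_add hint' (integrable_const _)]
          simp
  calc ∑ k ∈ Finset.range N, (if k + 1 < m then 0 else ν.real {z | k < T z} * (L * D))
      = (∑ k ∈ Finset.range N, (if k + 1 < m then 0 else ν.real {z | k < T z})) * (L * D) := by
        rw [Finset.sum_mul]
        exact Finset.sum_congr rfl fun k _ => by split_ifs <;> simp
    _ ≤ _ := by
        rw [mul_comm]
        exact mul_le_mul_of_nonneg_left hcount (by positivity)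

/-- Lower bound on the delay of a bounded stopping time `T`: Jensen's inequality for the
change of measure from no change to the change-points `γ`. -/
lemma neg_log_le_delay_of_bounded (μ₀ μ₁ : Measure 𝓧) [IsProbabilityMeasure μ₀]
    [IsProbabilityMeasure μ₁] (hac : μ₁ ≪ μ₀) (hint : Integrable (llr μ₁ μ₀) μ₁)
    (hD : 0 ≤ ∫ x, llr μ₁ μ₀ x ∂μ₁) (γ : Fin L → ℕ) (m : ℕ) (hm : ∀ ℓ, m ≤ γ ℓ)
    (N : ℕ) (T : (ℕ → Fin L → 𝓧) → ℕ) (hTN : ∀ z, T z ≤ N)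
    (hT : ∀ n, MeasurableSet[pastEvents _ n] {z | T z ≤ n}) {q a : ℝ} (hq : 0 < q) (hq1 : q ≤ 1)
    (ha : 0 < a) (h : ∑ n ∈ Finset.range (N + 1),
      ENNReal.ofReal (q ^ (n + 1)) * noChangeLaw L μ₀ {z | T z = n} ≤ ENNReal.ofReal a) :
    -Real.log a ≤ (L * (∫ x, llr μ₁ μ₀ x ∂μ₁) - Real.log q) *
        (∫ z, ((T z - m : ℕ) : ℝ) ∂observationLaw μ₀ μ₁ γ) +
      (L * (∫ x, llr μ₁ μ₀ x ∂μ₁) - Real.log q * (m + 1)) := by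
  obtain ⟨hSi, hS⟩ := integral_sum_stepLLR_le μ₀ μ₁ hint hD γ m hm N T hTN hT
  set D := ∫ x, llr μ₁ μ₀ x ∂μ₁
  set ν := observationLaw μ₀ μ₁ γ
  set S : (ℕ → Fin L → 𝓧) → ℝ := fun z => ∑ k ∈ Finset.range (T z), stepLLR μ₀ μ₁ γ k (z k)
  have hTm : Measurable T := measurable_of_Iic fun n => pastEvents_le _ n _ (hT n)
  have heq : ∀ n, MeasurableSet[pastEvents _ n] {z | T z = n} := fun n => by
    rcases n with _ | n
    · simpa using hT 0
    · have : {z | T z = n + 1} = {z | T z ≤ n + 1} \ {z | T z ≤ n} := by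
        ext z
        change T z = n + 1 ↔ T z ≤ n + 1 ∧ ¬ T z ≤ n
        omega
      rw [this]
      exact (hT _).diff (pastEvents_mono _ n.le_succ _ (hT n))
  have hTi : ∀ f : ℕ → ℕ, (∀ n, f n ≤ n) → Integrable (fun z => (f (T z) : ℝ)) ν := fun f hf =>
    Integrable.of_bound (C := N)
      (((measurable_from_top (f := fun n : ℕ => (f n : ℝ))).comp hTm).aestronglyMeasurable)
      (ae_of_all _ fun z => by
        rw [Real.norm_natCast]
        exact_mod_cast (hf _).trans (hTN z))
  have hTi1 : Integrable (fun z => (T z : ℝ)) ν := hTi id fun _ => le_rfl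
  have hTi2 : Integrable (fun z => ((T z - m : ℕ) : ℝ)) ν := hTi (· - m) fun n => Nat.sub_le n m
  -- Here `exp u = q^(T+1) exp(-S) / a` has expectation at most one by the change of measure.
  -- Jensen's inequality then reduces to integrating `u + 1 ≤ exp u`.
  set u : (ℕ → Fin L → 𝓧) → ℝ := fun z => (T z + 1) * Real.log q - S z - Real.log a
  have hTi3 : Integrable (fun z => ((T z : ℝ) + 1) * Real.log q) ν :=
    (hTi1.add (integrable_const 1)).mul_const _
  have hTi4 : Integrable (fun z => ((T z : ℝ) + 1) * Real.log q - S z) ν := hTi3.sub hSi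
  have hui : Integrable u ν := hTi4.sub (integrable_const _)
  have hu : ∫ z, u z ∂ν = (∫ z, (T z : ℝ) ∂ν + 1) * Real.log q - ∫ z, S z ∂ν - Real.log a := by
    rw [integral_sub hTi4 (integrable_const _), integral_sub hTi3 hSi, integral_mul_const,
      integral_add hTi1 (integrable_const _)]
    simp
  have hexp : ∫⁻ z, ENNReal.ofReal (Real.exp (u z)) ∂ν ≤ 1 := by
    have huniv : (⋃ n ∈ Finset.range (N + 1), {z | T z = n}) = Set.univ := by
      ext z
      simpa using Nat.lt_succ_of_le (hTN z)
    rw [← setLIntegral_univ, ← huniv, lintegral_biUnion_finset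
      (fun i _ j _ hij => Set.disjoint_left.2 fun z hi hj => hij (hi.symm.trans hj))
      (fun n _ => pastEvents_le _ n _ (heq n))]
    calc ∑ n ∈ Finset.range (N + 1), ∫⁻ z in {z | T z = n}, ENNReal.ofReal (Real.exp (u z)) ∂ν
        ≤ ∑ n ∈ Finset.range (N + 1), ENNReal.ofReal a⁻¹ *
            (ENNReal.ofReal (q ^ (n + 1)) * noChangeLaw L μ₀ {z | T z = n}) := by
          refine Finset.sum_le_sum fun n _ => ?_
          have hcongr : ∀ z ∈ {z | T z = n}, ENNReal.ofReal (Real.exp (u z)) =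
              ENNReal.ofReal a⁻¹ * ENNReal.ofReal (q ^ (n + 1)) * ENNReal.ofReal
                (Real.exp (-∑ k ∈ Finset.range n, stepLLR μ₀ μ₁ γ k (z k))) := by
            intro z hz
            have hz' : T z = n := hz
            rw [← ENNReal.ofReal_mul (by positivity), ← ENNReal.ofReal_mul (by positivity)]
            congr 1
            simp only [u, S, hz']
            rw [sub_eq_add_neg, sub_eq_add_neg, Real.exp_add, Real.exp_add, Real.exp_neg (Real.log a),
              Real.exp_log ha, mul_comm _ (Real.log q), Real.exp_mul, Real.exp_log hq]
            norm_cast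
            ring
          rw [setLIntegral_congr_fun (pastEvents_le _ n _ (heq n)) hcongr,
            lintegral_const_mul' _ _ (by finiteness), mul_assoc]
          gcongr
          exact setLIntegral_exp_neg_stepLLR_le μ₀ μ₁ hac γ n (heq n)
      _ ≤ ENNReal.ofReal a⁻¹ * ENNReal.ofReal a := by
          rw [← Finset.mul_sum]
          gcongr
      _ = 1 := by
          rw [← ENNReal.ofReal_mul (by positivity), inv_mul_cancel₀ ha.ne', ENNReal.ofReal_one]
  have hexpi : Integrable (fun z => Real.exp (u z)) ν := by
    refine ⟨(Real.continuous_exp.comp_aestronglyMeasurable hui.1), ?_⟩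
    rw [hasFiniteIntegral_iff_ofReal (ae_of_all _ fun z => (Real.exp_pos _).le)]
    exact hexp.trans_lt ENNReal.one_lt_top
  have hexp' : ∫ z, Real.exp (u z) ∂ν ≤ 1 := by
    rw [integral_eq_lintegral_of_nonneg_ae (ae_of_all _ fun z => (Real.exp_pos _).le) hexpi.1]
    exact ENNReal.toReal_le_of_le_ofReal zero_le_one (by simpa using hexp)
  have hle : ∫ z, u z ∂ν + 1 ≤ 1 := by
    calc ∫ z, u z ∂ν + 1 = ∫ z, (u z + 1) ∂ν := by
          rw [integral_add hui (integrable_const _)]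
          simp
      _ ≤ ∫ z, Real.exp (u z) ∂ν :=
          integral_mono (hui.add (integrable_const _)) hexpi fun z => Real.add_one_le_exp (u z)
      _ ≤ 1 := hexp'
  have hTle : ∫ z, (T z : ℝ) ∂ν ≤ ∫ z, ((T z - m : ℕ) : ℝ) ∂ν + m := by
    calc ∫ z, (T z : ℝ) ∂ν ≤ ∫ z, (((T z - m : ℕ) : ℝ) + m) ∂ν := by
          refine integral_mono hTi1 (hTi2.add (integrable_const _)) fun z => ?_
          have : T z ≤ (T z - m) + m := by omega
          beta_reduce
          exact_mod_cast this
      _ = _ := by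
          rw [integral_add hTi2 (integrable_const _)]
          simp
  have hlog : 0 ≤ -Real.log q := by simpa using Real.log_nonpos hq.le hq1
  have := mul_le_mul_of_nonneg_left hTle hlog
  rw [hu] at hle
  have hS' : ∫ z, S z ∂ν ≤ L * D * (∫ z, ((T z - m : ℕ) : ℝ) ∂ν + 1) := hS
  linarith

/-- Lower bound on the delay of a stopping time `σ` whose probability of stopping before an
independent geometric time is at most `α`. -/
lemma neg_log_le_delay (μ₀ μ₁ : Measure 𝓧) [IsProbabilityMeasure μ₀]
    [IsProbabilityMeasure μ₁] (hac : μ₁ ≪ μ₀) (hint : Integrable (llr μ₁ μ₀) μ₁)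
    (hD : 0 ≤ ∫ x, llr μ₁ μ₀ x ∂μ₁) (γ : Fin L → ℕ) (m : ℕ) (hm : ∀ ℓ, m ≤ γ ℓ)
    (σ : (ℕ → Fin L → 𝓧) → ℕ∞) (hσ : ∀ n : ℕ, MeasurableSet[pastEvents _ n] {z | σ z ≤ n})
    {q α : ℝ} (hq : 0 < q) (hq1 : q < 1) (hα : 0 < α)
    (h : ∑' n : ℕ, ENNReal.ofReal (q ^ (n + 1)) * noChangeLaw L μ₀ {z | σ z = n} ≤
      ENNReal.ofReal α) :
    ENNReal.ofReal (-Real.log α) ≤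
      ENNReal.ofReal (L * (∫ x, llr μ₁ μ₀ x ∂μ₁) - Real.log q) *
        (∫⁻ z, ((σ z - (m : ℕ∞) : ℕ∞) : ℝ≥0∞) ∂observationLaw μ₀ μ₁ γ) +
      ENNReal.ofReal (L * (∫ x, llr μ₁ μ₀ x ∂μ₁) - Real.log q * (m + 1)) := by
  set D := ∫ x, llr μ₁ μ₀ x ∂μ₁
  set I := ∫⁻ z, ((σ z - (m : ℕ∞) : ℕ∞) : ℝ≥0∞) ∂observationLaw μ₀ μ₁ γ
  have hlog : 0 < -Real.log q := by simpa using Real.log_neg hq hq1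
  have hC : 0 < L * D - Real.log q := by have : 0 ≤ L * D := by positivity
                                         linarith
  have hK : 0 ≤ L * D - Real.log q * (m + 1) := by
    have : 0 ≤ L * D := by positivity
    have : 0 ≤ -Real.log q * (m + 1) := by positivity
    linarith
  by_cases hI : I = ∞
  · rw [hI, ENNReal.mul_top (by simpa using hC), top_add]
    exact le_top
  -- Truncating `σ` at `N` alters only the mass at `N`, which costs at most `q^(N+1)` and disappears
  -- as `N → ∞`. This also covers `σ = ∞`.
  have hbound : ∀ N : ℕ, -Real.log (α + q ^ (N + 1)) ≤
      (L * D - Real.log q) * I.toReal + (L * D - Real.log q * (m + 1)) := by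
    intro N
    set T : (ℕ → Fin L → 𝓧) → ℕ := fun z => (min (σ z) N).toNat
    have hTc : ∀ z, (T z : ℕ∞) = min (σ z) N := fun z =>
      ENat.natCast_toNat (ne_top_of_le_ne_top (ENat.natCast_ne_top N) (min_le_right _ _))
    have hTN : ∀ z, T z ≤ N := fun z => by
      have : (T z : ℕ∞) ≤ N := by rw [hTc]; exact min_le_right _ _
      exact_mod_cast this
    have hT : ∀ n, MeasurableSet[pastEvents _ n] {z | T z ≤ n} := by
      intro n
      rcases le_or_gt N n with hn | hn
      · rw [show {z | T z ≤ n} = Set.univ from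
          Set.eq_univ_of_forall fun z => (hTN z).trans hn]
        exact MeasurableSet.univ
      · convert hσ n using 1
        ext z
        change T z ≤ n ↔ σ z ≤ n
        rw [← Nat.cast_le (α := ℕ∞), hTc, min_le_iff, Nat.cast_le]
        exact or_iff_left (not_le.2 hn)
    have hTeq : ∀ n < N, {z | T z = n} = {z | σ z = n} := by
      intro n hn
      ext z
      change T z = n ↔ σ z = n
      rw [← Nat.cast_inj (R := ℕ∞), hTc]
      constructor
      · intro hz
        rcases min_choice (σ z) (N : ℕ∞) with h' | h'
        · rwa [h'] at hz
        · rw [h', Nat.cast_inj] at hz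
          omega
      · rintro hz
        rw [hz, min_eq_left (by exact_mod_cast hn.le)]
    have hsum : ∑ n ∈ Finset.range (N + 1),
        ENNReal.ofReal (q ^ (n + 1)) * noChangeLaw L μ₀ {z | T z = n} ≤
          ENNReal.ofReal (α + q ^ (N + 1)) := by
      rw [Finset.sum_range_succ, ENNReal.ofReal_add hα.le (by positivity)]
      gcongr
      · rw [Finset.sum_congr rfl fun n hn => by rw [hTeq n (Finset.mem_range.1 hn)]]
        exact (ENNReal.sum_le_tsum _).trans h
      · exact mul_le_of_le_one_right' prob_le_one
    have hmain := neg_log_le_delay_of_bounded μ₀ μ₁ hac hint hD γ m hm N T hTN hT hq hq1.le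
      (by positivity) hsum
    have hle : ∫ z, ((T z - m : ℕ) : ℝ) ∂observationLaw μ₀ μ₁ γ ≤ I.toReal := by
      by_cases hi : Integrable (fun z => ((T z - m : ℕ) : ℝ)) (observationLaw μ₀ μ₁ γ)
      · rw [integral_eq_lintegral_of_nonneg_ae (ae_of_all _ fun z => Nat.cast_nonneg _) hi.1]
        refine ENNReal.toReal_mono hI (lintegral_mono fun z => ?_)
        rw [ENNReal.ofReal_natCast, ← ENat.toENNReal_coe, ENat.toENNReal_le, ENat.natCast_sub, hTc]
        exact tsub_le_tsub_right (min_le_left _ _) _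
      -- The Bochner integral is `0` by convention in this case, so integrability need not be
      -- proved.
      · rw [integral_undef hi]
        exact ENNReal.toReal_nonneg
    calc _ ≤ _ := hmain
      _ ≤ _ := by gcongr
  have hlim : Tendsto (fun N : ℕ => -Real.log (α + q ^ (N + 1))) atTop (𝓝 (-Real.log α)) := by
    have h1 : Tendsto (fun N : ℕ => α + q ^ (N + 1)) atTop (𝓝 (α + 0)) :=
      tendsto_const_nhds.add
        ((tendsto_pow_atTop_nhds_zero_of_lt_one hq.le hq1).comp (tendsto_add_atTop_nat 1))
    rw [add_zero] at h1
    exact (h1.log hα.ne').neg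
  have hfin := le_of_tendsto' hlim hbound
  calc ENNReal.ofReal (-Real.log α)
      ≤ ENNReal.ofReal ((L * D - Real.log q) * I.toReal + (L * D - Real.log q * (m + 1))) :=
        ENNReal.ofReal_le_ofReal hfin
    _ = _ := by
        rw [ENNReal.ofReal_add (mul_nonneg hC.le ENNReal.toReal_nonneg) hK,
          ENNReal.ofReal_mul hC.le, ENNReal.ofReal_toReal hI]

end Delay

/-! ### The law of the change-points -/

lemma measurable_sum_Iic (L : ℕ) :
    Measurable fun (d : Fin L → ℕ) (ℓ : Fin L) => ∑ j ∈ Finset.Iic ℓ, d j :=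
  measurable_pi_lambda _ fun _ => Finset.measurable_sum _ fun j _ => measurable_pi_apply j

instance isProbabilityMeasure_changePointLaw {L : ℕ} (ρ : Fin L → unitInterval) :
    IsProbabilityMeasure (changePointLaw ρ) :=
  Measure.isProbabilityMeasure_map (measurable_sum_Iic L).aemeasurable

lemma changePointLaw_map_eval_zero {L : ℕ} [NeZero L] (ρ : Fin L → unitInterval) :
    (changePointLaw ρ).map (fun γ => γ 0) = geometricMeasure (ρ 0) := by
  rw [changePointLaw, Measure.map_map (measurable_pi_apply 0) (measurable_sum_Iic L)]
  have : (Finset.Iic (0 : Fin L)) = {0} := by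
    ext j
    simp
  have h : ((fun γ : Fin L → ℕ => γ 0) ∘ fun (d : Fin L → ℕ) (ℓ : Fin L) =>
      ∑ j ∈ Finset.Iic ℓ, d j) = Function.eval 0 := by
    funext d
    simp [this]
  rw [h]
  exact (measurePreserving_eval _ 0).map_eq

/-- Propagation delays are nonnegative. The parameters other than `ρ 0` enter the lower bound
through this ordering only. -/
lemma ae_changePointLaw_zero_le {L : ℕ} [NeZero L] (ρ : Fin L → unitInterval) :
    ∀ᵐ γ ∂changePointLaw ρ, ∀ ℓ, γ 0 ≤ γ ℓ := by
  rw [changePointLaw, ae_map_iff (measurable_sum_Iic L).aemeasurable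
    (Set.to_countable _).measurableSet]
  exact ae_of_all _ fun d ℓ => Finset.sum_le_sum_of_subset (Finset.Iic_subset_Iic.2 (Fin.zero_le ℓ))

/-- The geometric law starts at `0`, so exceeding `n` means `n + 1` failures; this is the source of
the exponent in `q ^ (n + 1)`. -/
lemma pow_le_geometricMeasure_gt {p : unitInterval} (hp : p ≠ 0) (n : ℕ) :
    ENNReal.ofReal ((1 - p : ℝ) ^ (n + 1)) ≤ geometricMeasure p {k | n < k} := by
  have hc : {k : ℕ | n < k} = (Finset.range (n + 1) : Set ℕ)ᶜ := by
    ext k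
    rw [Set.mem_compl_iff, Finset.mem_coe, Finset.mem_range]
    change n < k ↔ _
    omega
  have hp0 : (p : ℝ) ≠ 0 := by simpa using hp
  have hs : (geometricMeasure p).real (Finset.range (n + 1) : Set ℕ) =
      1 - (1 - p : ℝ) ^ (n + 1) := by
    rw [← sum_measureReal_singleton]
    simp_rw [geometricMeasure_real_singleton hp]
    rw [← Finset.sum_mul, geom_sum_eq (by simpa using hp), sub_sub_cancel_left, div_neg,
      ← neg_div, div_mul_cancel₀ _ hp0, neg_sub]
  rw [hc, ← ofReal_measureReal, probReal_compl_eq_one_sub (Finset.measurableSet _), hs]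
  simp

/-- Finiteness of the geometric mean keeps the averaged error term bounded independently of `α`. -/
lemma lintegral_geometricMeasure_ne_top {p : unitInterval} (hp : p ≠ 0) (a b : ℝ) :
    ∫⁻ n, ENNReal.ofReal (a + b * n) ∂geometricMeasure p ≠ ∞ := by
  have hi : Integrable (fun n : ℕ => (n : ℝ)) (geometricMeasure p) := by
    rw [integrable_geometricMeasure_iff hp]
    have hp0 : (0 : ℝ) < p := lt_of_le_of_ne p.2.1 fun h => hp (by ext; exact h.symm)
    have h1 : ‖(1 - p : ℝ)‖ < 1 := by
      rw [Real.norm_eq_abs, abs_lt]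
      constructor <;> linarith [p.2.2]
    refine ((summable_pow_mul_geometric_of_norm_lt_one 1 h1).mul_right (p : ℝ)).congr fun n => ?_
    simp only [Real.norm_natCast]
    ring
  exact ((integrable_const a).add (hi.const_mul b)).lintegral_lt_top.ne

/-! ### Conditioning on the change-points and reduction to sequence space -/

section System

variable {Ω 𝓧 : Type*} [MeasurableSpace Ω] [MeasurableSpace 𝓧] {L : ℕ}
  {ρ : Fin L → unitInterval} {μ₀ μ₁ : Measure 𝓧} {P : Measure Ω}
  {Γ : Fin L → Ω → ℕ} {Z : ℕ → Fin L → Ω → 𝓧}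

namespace IsChangeProcessSystem

lemma measurable_changePoints (h : IsChangeProcessSystem ρ μ₀ μ₁ P Γ Z) :
    Measurable fun ω ℓ => Γ ℓ ω :=
  measurable_pi_lambda _ h.measurable_changePoint

lemma measurable_observations (h : IsChangeProcessSystem ρ μ₀ μ₁ P Γ Z) :
    Measurable fun ω k ℓ => Z k ℓ ω :=
  measurable_pi_lambda _ fun k => measurable_pi_lambda _ fun ℓ => h.measurable_obs k ℓ

lemma isProbabilityMeasure (h : IsChangeProcessSystem ρ μ₀ μ₁ P Γ Z) :
    IsProbabilityMeasure P := by
  constructor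
  have := h.law_changePoint ▸ Measure.map_apply (μ := P) h.measurable_changePoints MeasurableSet.univ
  simpa using this.symm

lemma ae_zero_le [NeZero L] (h : IsChangeProcessSystem ρ μ₀ μ₁ P Γ Z) :
    ∀ᵐ ω ∂P, ∀ ℓ, Γ 0 ω ≤ Γ ℓ ω := by
  have := ae_changePointLaw_zero_le ρ
  rw [← h.law_changePoint] at this
  exact ae_of_ae_map h.measurable_changePoints.aemeasurable this

lemma map_changePoint_zero [NeZero L] (h : IsChangeProcessSystem ρ μ₀ μ₁ P Γ Z) :
    P.map (Γ 0) = geometricMeasure (ρ 0) := by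
  rw [← changePointLaw_map_eval_zero, ← h.law_changePoint,
    Measure.map_map (measurable_pi_apply 0) h.measurable_changePoints]
  rfl

lemma measure_changePoints_eq_zero [NeZero L] (h : IsChangeProcessSystem ρ μ₀ μ₁ P Γ Z)
    {γ : Fin L → ℕ} (hγ : ¬ ∀ ℓ, γ 0 ≤ γ ℓ) : P {ω | ∀ ℓ, Γ ℓ ω = γ ℓ} = 0 := by
  refine measure_mono_null (t := {ω | ¬ ∀ ℓ, Γ 0 ω ≤ Γ ℓ ω}) (fun ω hω hle => hγ fun ℓ => ?_)
    h.ae_zero_le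
  have hω' : ∀ ℓ, Γ ℓ ω = γ ℓ := hω
  rw [← hω', ← hω']
  exact hle ℓ

lemma measurableSet_changePoints (h : IsChangeProcessSystem ρ μ₀ μ₁ P Γ Z) (γ : Fin L → ℕ) :
    MeasurableSet {ω | ∀ ℓ, Γ ℓ ω = γ ℓ} := by
  have : {ω | ∀ ℓ, Γ ℓ ω = γ ℓ} = (fun ω ℓ => Γ ℓ ω) ⁻¹' {γ} := by
    ext ω
    exact funext_iff.symm
  rw [this]
  exact h.measurable_changePoints (measurableSet_singleton γ)

/-- The change-point vector takes countably many values, so its level sets partition the space and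
`f` need not be measurable. -/
lemma lintegral_eq_tsum (h : IsChangeProcessSystem ρ μ₀ μ₁ P Γ Z) (f : Ω → ℝ≥0∞) :
    ∫⁻ ω, f ω ∂P = ∑' γ : Fin L → ℕ, ∫⁻ ω in {ω | ∀ ℓ, Γ ℓ ω = γ ℓ}, f ω ∂P := by
  rw [← lintegral_iUnion h.measurableSet_changePoints, ← setLIntegral_univ]
  · congr 2
    refine (Set.eq_univ_of_forall fun ω => Set.mem_iUnion.2 ⟨fun ℓ => Γ ℓ ω, ?_⟩).symm
    exact fun _ => rfl
  · intro γ γ' hne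
    refine Set.disjoint_left.2 fun ω hω hω' => hne (funext fun ℓ => ?_)
    exact (hω ℓ).symm.trans (hω' ℓ)

lemma setLIntegral_observations [IsProbabilityMeasure μ₀] [IsProbabilityMeasure μ₁]
    (h : IsChangeProcessSystem ρ μ₀ μ₁ P Γ Z) (γ : Fin L → ℕ)
    {f : (ℕ → Fin L → 𝓧) → ℝ≥0∞} (hf : Measurable f) :
    ∫⁻ ω in {ω | ∀ ℓ, Γ ℓ ω = γ ℓ}, f (fun k ℓ => Z k ℓ ω) ∂P =
      P {ω | ∀ ℓ, Γ ℓ ω = γ ℓ} * ∫⁻ z, f z ∂observationLaw μ₀ μ₁ γ := by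
  have hmap : (P.restrict {ω | ∀ ℓ, Γ ℓ ω = γ ℓ}).map (fun ω k ℓ => Z k ℓ ω) =
      P {ω | ∀ ℓ, Γ ℓ ω = γ ℓ} • observationLaw μ₀ μ₁ γ := by
    ext A hA
    rw [Measure.map_apply h.measurable_observations hA,
      Measure.restrict_apply (h.measurable_observations hA), Measure.smul_apply, smul_eq_mul,
      ← h.condLaw_obs γ A hA, Set.inter_comm]
    rfl
  rw [← lintegral_map hf h.measurable_observations, hmap, lintegral_smul_measure, smul_eq_mul]

/-- Up to time `n`, the observations are independent of the event that no change has occurred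
by time `n`, on which they follow the law without change. -/
lemma measure_lt_changePoint_inter [NeZero L] [IsProbabilityMeasure μ₀] [IsProbabilityMeasure μ₁]
    (h : IsChangeProcessSystem ρ μ₀ μ₁ P Γ Z) (n : ℕ) {A : Set (ℕ → Fin L → 𝓧)}
    (hA : MeasurableSet[pastEvents _ n] A) :
    P {ω | n < Γ 0 ω ∧ (fun k ℓ => Z k ℓ ω) ∈ A} = P {ω | n < Γ 0 ω} * noChangeLaw L μ₀ A := by
  have hA' := pastEvents_le _ n A hA
  have hm : MeasurableSet {ω | n < Γ 0 ω} := h.measurable_changePoint 0 (measurableSet_Ioi (a := n))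
  have hm' : MeasurableSet {ω | n < Γ 0 ω ∧ (fun k ℓ => Z k ℓ ω) ∈ A} :=
    hm.inter (h.measurable_observations hA')
  rw [← lintegral_indicator_one hm', ← lintegral_indicator_one hm, h.lintegral_eq_tsum,
    h.lintegral_eq_tsum, ← ENNReal.tsum_mul_right]
  refine tsum_congr fun γ => ?_
  by_cases hγ : ∀ ℓ, γ 0 ≤ γ ℓ
  swap
  · rw [setLIntegral_measure_zero _ _ (h.measure_changePoints_eq_zero hγ),
      setLIntegral_measure_zero _ _ (h.measure_changePoints_eq_zero hγ), zero_mul]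
  rw [lintegral_indicator_one hm', lintegral_indicator_one hm, Measure.restrict_apply hm',
    Measure.restrict_apply hm]
  by_cases hn : n < γ 0
  · have h1 : {ω | n < Γ 0 ω ∧ (fun k ℓ => Z k ℓ ω) ∈ A} ∩ {ω | ∀ ℓ, Γ ℓ ω = γ ℓ} =
        {ω | (∀ ℓ, Γ ℓ ω = γ ℓ) ∧ (fun k ℓ => Z k ℓ ω) ∈ A} := by
      ext ω
      exact ⟨fun hω => ⟨hω.2, hω.1.2⟩, fun hω => ⟨⟨hn.trans_eq (hω.1 0).symm, hω.2⟩, hω.1⟩⟩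
    have h2 : {ω | n < Γ 0 ω} ∩ {ω | ∀ ℓ, Γ ℓ ω = γ ℓ} = {ω | ∀ ℓ, Γ ℓ ω = γ ℓ} := by
      ext ω
      exact ⟨fun hω => hω.2, fun hω => ⟨hn.trans_eq (hω 0).symm, hω⟩⟩
    rw [h1, h2, h.condLaw_obs γ A hA']
    congr 1
    refine infinitePi_congr_of_pastEvents _ _ n (fun k hk => ?_) hA
    congr 1 with ℓ
    -- For `k < n` one has `k + 1 ≤ n < γ 0 ≤ γ ℓ`, so every sensor is still before its change.
    rw [if_pos]
    have := hγ ℓ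
    omega
  · have h2 : {ω | n < Γ 0 ω} ∩ {ω | ∀ ℓ, Γ ℓ ω = γ ℓ} = ∅ := by
      ext ω
      exact ⟨fun hω => hn (hω.2 0 ▸ hω.1), fun hω => hω.elim⟩
    have h1 : {ω | n < Γ 0 ω ∧ (fun k ℓ => Z k ℓ ω) ∈ A} ∩ {ω | ∀ ℓ, Γ ℓ ω = γ ℓ} = ∅ := by
      ext ω
      exact ⟨fun hω => hn (hω.2 0 ▸ hω.1.1), fun hω => hω.elim⟩
    rw [h1, h2, measure_empty, zero_mul]

end IsChangeProcessSystem

/-- A stopping time of the observation filtration is a stopping time evaluated at the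
sequence of observations. -/
lemma exists_stopping_on_sequences (hZ : ∀ k ℓ, Measurable (Z k ℓ)) {τ : Ω → ℕ∞}
    (hτ : IsStoppingTime (obsFiltration Z hZ) τ) :
    ∃ σ : (ℕ → Fin L → 𝓧) → ℕ∞, (∀ n : ℕ, MeasurableSet[pastEvents _ n] {z | σ z ≤ n}) ∧
      ∀ ω, τ ω = σ fun k ℓ => Z k ℓ ω := by
  have hle : ∀ n, obsFiltration Z hZ n ≤
      (pastEvents (Fin L → 𝓧) n).comap fun ω k ℓ => Z k ℓ ω := by
    intro n
    refine iSup_le fun k => iSup_le fun hk => iSup_le fun ℓ => ?_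
    have hmeas : Measurable[pastEvents (Fin L → 𝓧) n] fun z : ℕ → Fin L → 𝓧 => z k ℓ :=
      (((measurable_pi_apply ℓ).comp (measurable_pi_apply (X := fun _ : Finset.range n => Fin L → 𝓧)
        ⟨k, Finset.mem_range.2 hk⟩)).comp (comap_measurable _))
    have : Z k ℓ = (fun z : ℕ → Fin L → 𝓧 => z k ℓ) ∘ fun ω k ℓ => Z k ℓ ω := rfl
    rw [this, ← MeasurableSpace.comap_comp]
    exact MeasurableSpace.comap_mono hmeas.comap_le
  choose A hA hAτ using fun n : ℕ => hle n _ (hτ n)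
  have hσ : ∀ z (n : ℕ), ⨅ (j : ℕ) (_ : z ∈ A j), (j : ℕ∞) ≤ n ↔ ∃ j ≤ n, z ∈ A j := by
    intro z n
    rw [← ENat.lt_add_one_iff (ENat.natCast_ne_top n)]
    simp only [iInf_lt_iff, exists_prop]
    refine exists_congr fun j => ?_
    rw [ENat.lt_add_one_iff (ENat.natCast_ne_top n), Nat.cast_le, and_comm]
  -- The sets `A j` need not be increasing outside the range of the observations, so `σ` is defined
  -- as the first index `j` with `z ∈ A j`, and `∞` if there is none.
  refine ⟨fun z => ⨅ (j : ℕ) (_ : z ∈ A j), (j : ℕ∞), fun n => ?_, fun ω => ?_⟩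
  · simp_rw [hσ]
    have : {z | ∃ j ≤ n, z ∈ A j} = ⋃ j, ⋃ (_ : j ≤ n), A j := by
      ext z
      simp
    rw [this]
    exact MeasurableSet.iUnion fun j => MeasurableSet.iUnion fun hj => pastEvents_mono _ hj _ (hA j)
  · have hiff : ∀ n : ℕ, (fun k ℓ => Z k ℓ ω) ∈ A n ↔ τ ω ≤ n := fun n =>
      Set.ext_iff.1 (hAτ n) ω
    have hiff' : ∀ n : ℕ, τ ω ≤ n ↔
        (⨅ (j : ℕ) (_ : (fun k ℓ => Z k ℓ ω) ∈ A j), (j : ℕ∞)) ≤ n := by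
      intro n
      rw [hσ]
      simp_rw [hiff]
      exact ⟨fun hn => ⟨n, le_rfl, hn⟩, fun ⟨j, hj, hn⟩ => hn.trans (by exact_mod_cast hj)⟩
    have hof : ∀ x y : ℕ∞, (∀ n : ℕ, y ≤ n → x ≤ n) → x ≤ y := by
      intro x y hxy
      cases y with
      | top => exact le_top
      | coe n => exact hxy n le_rfl
    exact le_antisymm (hof _ _ fun n => (hiff' n).2) (hof _ _ fun n => (hiff' n).1)

end System

/-! ### Averaging over the change-points and the asymptotic bound -/

/-- Non-asymptotic lower bound on the expected delay of a detection procedure. -/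
lemma neg_log_le_expectedDelay {Ω 𝓧 : Type*} [MeasurableSpace Ω] [MeasurableSpace 𝓧] {L : ℕ}
    [NeZero L] {ρ : Fin L → unitInterval} (hρ_lt : (ρ 0 : ℝ) < 1) (hρ_pos : 0 < (ρ 0 : ℝ))
    {μ₀ μ₁ : Measure 𝓧} [IsProbabilityMeasure μ₀] [IsProbabilityMeasure μ₁] (hac : μ₁ ≪ μ₀)
    (hint : Integrable (llr μ₁ μ₀) μ₁) (hD : 0 ≤ ∫ x, llr μ₁ μ₀ x ∂μ₁) {P : Measure Ω}
    {Γ : Fin L → Ω → ℕ} {Z : ℕ → Fin L → Ω → 𝓧} (h : IsChangeProcessSystem ρ μ₀ μ₁ P Γ Z)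
    {α : ℝ} (hα : 0 < α) {τ : Ω → ℕ∞}
    (hτ : τ ∈ detectionClass P (obsFiltration Z h.measurable_obs) (Γ 0) α) :
    ENNReal.ofReal (-Real.log α) ≤
      ENNReal.ofReal (L * (∫ x, llr μ₁ μ₀ x ∂μ₁) - Real.log (1 - ρ 0)) *
          expectedDelay P (Γ 0) τ +
        ∫⁻ n, ENNReal.ofReal (L * (∫ x, llr μ₁ μ₀ x ∂μ₁) - Real.log (1 - ρ 0) * (n + 1))
          ∂geometricMeasure (ρ 0) := by
  obtain ⟨hτ_st, hfa⟩ := hτ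
  obtain ⟨σ, hσ, hτσ⟩ := exists_stopping_on_sequences h.measurable_obs hτ_st
  have hp : ρ 0 ≠ 0 := fun h0 => by simp [h0] at hρ_pos
  have hP := h.isProbabilityMeasure
  set D := ∫ x, llr μ₁ μ₀ x ∂μ₁
  set q : ℝ := 1 - ρ 0 with hq_def
  have hq : 0 < q := by linarith
  have hq1 : q < 1 := by linarith
  have hσeq : ∀ n : ℕ, MeasurableSet[pastEvents _ n] {z | σ z = n} := fun n => by
    rcases n with _ | n
    · simpa using hσ 0
    · have : {z | σ z = (n + 1 : ℕ)} = {z | σ z ≤ (n + 1 : ℕ)} \ {z | σ z ≤ n} := by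
        ext z
        change σ z = (n + 1 : ℕ) ↔ σ z ≤ (n + 1 : ℕ) ∧ ¬ σ z ≤ n
        rw [not_le, ← ENat.add_one_le_iff (ENat.natCast_ne_top n), Nat.cast_add, Nat.cast_one,
          le_antisymm_iff]
      rw [this]
      exact (hσ _).diff (pastEvents_mono _ n.le_succ _ (hσ n))
  have hσm : Measurable σ := by
    refine measurable_to_countable' fun x => ?_
    have hn : ∀ n : ℕ, MeasurableSet (σ ⁻¹' {(n : ℕ∞)}) := fun n =>
      pastEvents_le _ n _ (hσeq n)
    cases x with
    | coe n => exact hn n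
    | top =>
      have : σ ⁻¹' {⊤} = (⋃ n : ℕ, σ ⁻¹' {(n : ℕ∞)})ᶜ := by
        ext z
        simp only [Set.mem_preimage, Set.mem_singleton_iff, Set.mem_compl_iff, Set.mem_iUnion,
          not_exists]
        exact ⟨fun hz n => by rw [hz]; exact (ENat.natCast_ne_top n).symm,
          fun hz => by_contra fun hne => hz _ (ENat.natCast_toNat hne).symm⟩
      rw [this]
      exact (MeasurableSet.iUnion hn).compl
  -- The false-alarm event splits according to the value `n` of `τ`; on each piece the constraint
  -- factors into the geometric tail and the no-change law.
  have hsum : ∑' n : ℕ, ENNReal.ofReal (q ^ (n + 1)) * noChangeLaw L μ₀ {z | σ z = n} ≤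
      ENNReal.ofReal α := by
    calc ∑' n : ℕ, ENNReal.ofReal (q ^ (n + 1)) * noChangeLaw L μ₀ {z | σ z = n}
        ≤ ∑' n : ℕ, P {ω | n < Γ 0 ω ∧ (fun k ℓ => Z k ℓ ω) ∈ {z | σ z = n}} := by
          refine ENNReal.tsum_le_tsum fun n => ?_
          rw [h.measure_lt_changePoint_inter n (hσeq n)]
          gcongr
          refine (pow_le_geometricMeasure_gt hp n).trans_eq ?_
          rw [← h.map_changePoint_zero]
          exact Measure.map_apply (h.measurable_changePoint 0) (measurableSet_Ioi (a := n))
      _ = P (⋃ n : ℕ, {ω | n < Γ 0 ω ∧ (fun k ℓ => Z k ℓ ω) ∈ {z | σ z = n}}) := by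
          refine (measure_iUnion ?_ fun n => ?_).symm
          · intro i j hij
            refine Set.disjoint_left.2 fun ω hi hj => hij ?_
            exact_mod_cast (show σ _ = (i : ℕ∞) from hi.2).symm.trans hj.2
          · exact (h.measurable_changePoint 0 (measurableSet_Ioi (a := n))).inter
              (h.measurable_observations (pastEvents_le _ n _ (hσeq n)))
      _ ≤ falseAlarmProb P (Γ 0) τ := by
          refine measure_mono (Set.iUnion_subset fun n ω hω => ?_)
          change τ ω < Γ 0 ω
          rw [hτσ, show σ _ = (n : ℕ∞) from hω.2]
          exact_mod_cast hω.1
      _ ≤ ENNReal.ofReal α := hfa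
  set K : ℕ → ℝ≥0∞ := fun n => ENNReal.ofReal (L * D - Real.log q * (n + 1))
  have hdelay : ∀ m : ℕ, Measurable fun z => ((σ z - (m : ℕ∞) : ℕ∞) : ℝ≥0∞) := fun m =>
    (measurable_from_top (f := fun x : ℕ∞ => ((x - (m : ℕ∞) : ℕ∞) : ℝ≥0∞))).comp hσm
  calc ENNReal.ofReal (-Real.log α)
      = ∑' γ : Fin L → ℕ, ∫⁻ _ in {ω | ∀ ℓ, Γ ℓ ω = γ ℓ}, ENNReal.ofReal (-Real.log α) ∂P := by
        rw [← h.lintegral_eq_tsum]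
        simp
    _ ≤ ∑' γ : Fin L → ℕ, ∫⁻ ω in {ω | ∀ ℓ, Γ ℓ ω = γ ℓ},
          (ENNReal.ofReal (L * D - Real.log q) * ((τ ω - (Γ 0 ω : ℕ∞) : ℕ∞) : ℝ≥0∞) +
            K (Γ 0 ω)) ∂P := by
        refine ENNReal.tsum_le_tsum fun γ => ?_
        by_cases hγ : ∀ ℓ, γ 0 ≤ γ ℓ
        swap
        · rw [setLIntegral_measure_zero _ _ (h.measure_changePoints_eq_zero hγ)]
          exact zero_le
        have hcongr : ∀ ω ∈ {ω | ∀ ℓ, Γ ℓ ω = γ ℓ},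
            ENNReal.ofReal (L * D - Real.log q) * ((τ ω - (Γ 0 ω : ℕ∞) : ℕ∞) : ℝ≥0∞) +
              K (Γ 0 ω) =
            (fun z => ENNReal.ofReal (L * D - Real.log q) *
              ((σ z - (γ 0 : ℕ∞) : ℕ∞) : ℝ≥0∞) + K (γ 0)) (fun k ℓ => Z k ℓ ω) := by
          intro ω hω
          rw [hτσ, show Γ 0 ω = γ 0 from hω 0]
        rw [setLIntegral_congr_fun (h.measurableSet_changePoints γ) hcongr,
          h.setLIntegral_observations γ (((hdelay _).const_mul _).add_const _),
          setLIntegral_const, mul_comm, lintegral_add_right _ measurable_const,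
          lintegral_const_mul _ (hdelay _), lintegral_const, measure_univ, mul_one]
        gcongr
        exact neg_log_le_delay μ₀ μ₁ hac hint hD γ (γ 0) hγ σ hσ hq hq1 hα hsum
    _ = ENNReal.ofReal (L * D - Real.log q) * expectedDelay P (Γ 0) τ +
          ∫⁻ n, K n ∂geometricMeasure (ρ 0) := by
        have hKΓ : Measurable fun ω => K (Γ 0 ω) :=
          (measurable_from_top (f := K)).comp (h.measurable_changePoint 0)
        rw [← h.lintegral_eq_tsum, lintegral_add_right _ hKΓ,
          lintegral_const_mul' _ _ ENNReal.ofReal_ne_top, ← h.map_changePoint_zero,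
          lintegral_map measurable_from_top (h.measurable_changePoint 0)]
        rfl

theorem mainTheorem4 {𝓧 : Type*} [MeasurableSpace 𝓧] (L : ℕ) [NeZero L]
    (ρ : Fin L → unitInterval) (hρ_lt : (ρ 0 : ℝ) < 1) (hρ_pos : ∀ ℓ, 0 < (ρ ℓ : ℝ))
    (μ₀ μ₁ : Measure 𝓧) [IsProbabilityMeasure μ₀] [IsProbabilityMeasure μ₁] :
    ∃ r : ℝ → ℝ, Tendsto r (𝓝[>] 0) (𝓝 0) ∧
      ∀ (Ω : Type*) [MeasurableSpace Ω] (P : Measure Ω) (Γ : Fin L → Ω → ℕ)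
        (Z : ℕ → Fin L → Ω → 𝓧) (h : IsChangeProcessSystem ρ μ₀ μ₁ P Γ Z)
        (α : ℝ), 0 < α → α < 1 →
        ENNReal.ofReal (Real.log (1 / (ρ 0 * α)) * (1 + r α)) /
            (L * klDiv μ₁ μ₀ + ENNReal.ofReal |Real.log (1 - ρ 0)|) ≤
          ⨅ τ ∈ detectionClass P (obsFiltration Z h.measurable_obs) (Γ 0) α,
            expectedDelay P (Γ 0) τ := by
  by_cases htop : klDiv μ₁ μ₀ = ∞
  · refine ⟨0, tendsto_const_nhds, fun Ω _ P Γ Z h α _ _ => ?_⟩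
    rw [htop, ENNReal.mul_top (by exact_mod_cast NeZero.ne L), top_add, ENNReal.div_top]
    exact zero_le
  obtain ⟨hac, hint⟩ := klDiv_ne_top_iff.1 htop
  have hρ0 := hρ_pos 0
  have hp : ρ 0 ≠ 0 := fun h0 => by simp [h0] at hρ0
  have hkl : klDiv μ₁ μ₀ = ENNReal.ofReal (∫ x, llr μ₁ μ₀ x ∂μ₁) := by
    rw [klDiv_of_ac_of_integrable hac hint]
    simp
  have hD : 0 ≤ ∫ x, llr μ₁ μ₀ x ∂μ₁ := by
    simpa using integral_llr_add_sub_measure_univ_nonneg hac hint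
  have hlogq : Real.log (1 - ρ 0) < 0 := Real.log_neg (by linarith) (by linarith)
  set D := ∫ x, llr μ₁ μ₀ x ∂μ₁
  set K : ℝ≥0∞ := ∫⁻ n : ℕ, ENNReal.ofReal (L * D - Real.log (1 - ρ 0) * (n + 1))
    ∂geometricMeasure (ρ 0)
  have hK : K ≠ ∞ := by
    convert lintegral_geometricMeasure_ne_top hp (L * D - Real.log (1 - ρ 0))
      (-Real.log (1 - ρ 0)) using 5
    ring
  have hC : L * klDiv μ₁ μ₀ + ENNReal.ofReal |Real.log (1 - ρ 0)| =
      ENNReal.ofReal (L * D - Real.log (1 - ρ 0)) := by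
    rw [hkl, abs_of_neg hlogq, sub_eq_add_neg (L * D), ENNReal.ofReal_add (by positivity) (by linarith),
      ENNReal.ofReal_mul (by positivity), ENNReal.ofReal_natCast]
  have hlog : ∀ α : ℝ, 0 < α → Real.log (1 / (ρ 0 * α)) = -Real.log (ρ 0) - Real.log α := by
    intro α hα
    rw [one_div, Real.log_inv, Real.log_mul hρ0.ne' hα.ne']
    ring
  -- This `r` is chosen so that `log (1 / (ρ 0 * α)) * (1 + r α) = -log α - K`. It involves `α`,
  -- `L`, `ρ 0` and `D` only, so it is uniform over all systems and stopping times.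
  refine ⟨fun α => -(K.toReal - Real.log (ρ 0)) / Real.log (1 / (ρ 0 * α)), ?_, ?_⟩
  · have h1 : Tendsto (fun α : ℝ => -Real.log (ρ 0) - Real.log α) (𝓝[>] 0) atTop := by
      simp_rw [sub_eq_add_neg]
      exact tendsto_atTop_add_const_left _ _
        (tendsto_neg_atBot_atTop.comp Real.tendsto_log_nhdsGT_zero)
    refine Tendsto.div_atTop tendsto_const_nhds (h1.congr' ?_)
    filter_upwards [self_mem_nhdsWithin] with α hα using (hlog α hα).symm
  · intro Ω _ P Γ Z h α hα hα1
    refine le_iInf₂ fun τ hτ => ?_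
    -- The bounds `α < 1` and `ρ 0 < 1` make this logarithm nonzero, so the division in `r` can be
    -- undone.
    have hne : Real.log (1 / (ρ 0 * α)) ≠ 0 := by
      have h1 : Real.log α < 0 := Real.log_neg hα hα1
      have h2 : Real.log (ρ 0) < 0 := Real.log_neg hρ0 hρ_lt
      rw [hlog α hα]
      linarith
    have hr : Real.log (1 / (ρ 0 * α)) *
        (1 + -(K.toReal - Real.log (ρ 0)) / Real.log (1 / (ρ 0 * α))) =
          -Real.log α - K.toReal := by
      rw [mul_add, mul_div_cancel₀ _ hne, hlog α hα]
      ring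
    rw [hC, hr, ENNReal.ofReal_sub _ ENNReal.toReal_nonneg, ENNReal.ofReal_toReal hK]
    refine ENNReal.div_le_of_le_mul' (tsub_le_iff_right.2 ?_)
    exact neg_log_le_expectedDelay hρ_lt hρ0 hac hint hD h hα hτ
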